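/- Let $G$ be a finite simple connected $3$-regular graph, and let $\lambda_2(G)$ denote the second largest eigenvalue of its adjacency matrix, eigenvalues being counted with multiplicity. If $\lambda_2(G) > 1$, then $\lambda_2(G) \ge \sqrt{2}$. Moreover, under the same assumptions, $\lambda_2(G) = \sqrt{2}$ if and only if $G$ is isomorphic to the Heawood graph, that is, to the point-line incidence graph of the projective plane $PG(2,2)$. -/

import Mathlib

theorem SimpleGraph.isHermitian_adjMatrix_real {V : Type*} [DecidableEq V]
    (G : SimpleGraph V) [DecidableRel G.Adj] : (G.adjMatrix ℝ).IsHermitian :=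
  (Matrix.conjTranspose_eq_transpose_of_trivial (G.adjMatrix ℝ)).trans G.isSymm_adjMatrix

/-- The second largest eigenvalue `λ₂(G)` of a finite graph: the eigenvalues of the adjacency matrix,
counted with multiplicity, are listed in decreasing order and the second entry is taken. (Graphs
with at most one vertex have no second eigenvalue; the value there is set to `0`.) -/
noncomputable def SimpleGraph.secondEigenvalue {V : Type*} [Fintype V] [DecidableEq V]
    (G : SimpleGraph V) [DecidableRel G.Adj] : ℝ :=
  if h : 1 < Fintype.card V then
    G.isHermitian_adjMatrix_real.eigenvalues₀ ⟨1, h⟩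
  else 0

/-- The nonzero vectors of the three-dimensional space over the field with two elements. They are
the homogeneous coordinate vectors of the points, and also of the lines, of the projective plane
`PG(2, 2)` (over this field each point and each line has exactly one coordinate vector). -/
abbrev FanoCoord : Type := {v : Fin 3 → ZMod 2 // v ≠ 0}

/-- The Heawood graph: the point-line incidence graph of the projective plane `PG(2, 2)`. The left
summand is the set of points, the right summand is the set of lines, and the point `p` is incident
with the line `l` when `p ⬝ᵥ l = 0`. -/
def heawoodGraph : SimpleGraph (FanoCoord ⊕ FanoCoord) where
  Adj x y := match x, y with
    | Sum.inl p, Sum.inr l => p.1 ⬝ᵥ l.1 = 0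
    | Sum.inr l, Sum.inl p => p.1 ⬝ᵥ l.1 = 0
    | _, _ => False
  symm := ⟨by rintro (a | a) (b | b) h <;> exact h⟩
  loopless := ⟨by rintro (a | a) h <;> exact h⟩

/-! The core claim is that a cubic graph with `1 < λ₂ ≤ √2` is the Heawood graph. Since the Heawood
graph itself has `λ₂ = √2`, both assertions follow.

The order `n` is pinned down spectrally. Rayleigh's inequality for vectors constant on two disjoint
sets (`card_mul_edgeCount_le`) excludes `n ≥ 16`, and excludes `k`-cycles once `n ≥ 2k + 2`, for `k
= 3, 4, 5`. For `n ≤ 10`, an entrywise nonnegative combination of `J`, `I`, `A`, `A²` has its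
spectrum bounded by its row sum, which forces `λ₂ ≤ 1` (`twelve_le_card`). So `n ≥ 12` and the girth
is at least six; the Moore bound gives `n ≥ 14`, and parity gives `n = 14`.

Equality in the Moore bound makes the graph bipartite with any two vertices of one class having a
unique common neighbour: a projective plane of order two, whose coordinates are then built by hand
(`exists_fano_labelling`). Conversely, the incidence matrix satisfies `N Nᵀ = 2I + J`, so a positive
eigenvalue other than `√2` has only constant eigenvectors. -/

open Matrix in
/-- The spectral theorem for a real Hermitian matrix, in terms of plain functions and `dotProduct`,
with the eigenvalues in decreasing order. -/
theorem Matrix.IsHermitian.exists_orthonormal_eigenvectors {V : Type*} [Fintype V] [DecidableEq V]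
    {A : Matrix V V ℝ} (hA : A.IsHermitian) :
    ∃ b : Fin (Fintype.card V) → V → ℝ,
      (∀ i, A *ᵥ b i = hA.eigenvalues₀ i • b i) ∧
      (∀ i j, b i ⬝ᵥ b j = if i = j then 1 else 0) ∧
      (∀ x y : V → ℝ, x ⬝ᵥ y = ∑ i, (b i ⬝ᵥ x) * (b i ⬝ᵥ y)) := by
  let e : Fin (Fintype.card V) ≃ V := Fintype.equivOfCardEq (Fintype.card_fin _)
  have hdot : ∀ x y : EuclideanSpace ℝ V, inner ℝ x y = x.ofLp ⬝ᵥ y.ofLp := by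
    intro x y
    simp [PiLp.inner_apply, dotProduct, mul_comm]
  refine ⟨fun i => (hA.eigenvectorBasis (e i)).ofLp, fun i => ?_, fun i j => ?_, fun x y => ?_⟩
  · have := hA.mulVec_eigenvectorBasis (e i)
    simpa [Matrix.IsHermitian.eigenvalues, e] using this
  · rw [← hdot, orthonormal_iff_ite.mp hA.eigenvectorBasis.orthonormal]
    simp
  · have h := hA.eigenvectorBasis.sum_inner_mul_inner (WithLp.toLp 2 x) (WithLp.toLp 2 y)
    simp only [hdot] at h
    rw [← h, ← e.sum_comp]
    exact Finset.sum_congr rfl fun i _ => by rw [dotProduct_comm x]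

/-! ### Rayleigh inequalities for `λ₂` of a regular graph. -/

namespace SimpleGraph

set_option linter.unusedSectionVars false

open Matrix

variable {V : Type*} [Fintype V] [DecidableEq V] {G : SimpleGraph V} [DecidableRel G.Adj]

theorem secondEigenvalue_eq (h : 1 < Fintype.card V) :
    G.secondEigenvalue = G.isHermitian_adjMatrix_real.eigenvalues₀ ⟨1, h⟩ := by
  simp [secondEigenvalue, h]

theorem dotProduct_adjMatrix_mulVec_comm (x y : V → ℝ) :
    x ⬝ᵥ G.adjMatrix ℝ *ᵥ y = y ⬝ᵥ G.adjMatrix ℝ *ᵥ x := by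
  rw [dotProduct_mulVec, ← mulVec_transpose, G.isSymm_adjMatrix.eq, dotProduct_comm]

theorem IsRegularOfDegree.adjMatrix_mulVec_one {d : ℕ} (hreg : G.IsRegularOfDegree d) :
    G.adjMatrix ℝ *ᵥ 1 = (d : ℝ) • (1 : V → ℝ) := by
  ext v
  simp [hreg.degree_eq v]

theorem IsRegularOfDegree.one_dotProduct_eq_zero {d : ℕ} (hreg : G.IsRegularOfDegree d)
    {x : V → ℝ} {μ : ℝ} (hx : G.adjMatrix ℝ *ᵥ x = μ • x) (hμ : μ ≠ d) : 1 ⬝ᵥ x = 0 := by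
  have h := G.dotProduct_adjMatrix_mulVec_comm 1 x
  rw [hx, hreg.adjMatrix_mulVec_one, dotProduct_smul, dotProduct_smul, dotProduct_comm x,
    smul_eq_mul, smul_eq_mul, ← sub_eq_zero, ← sub_mul] at h
  exact (mul_eq_zero.mp h).resolve_left (sub_ne_zero.mpr hμ)

/-- In a regular graph with `λ₂` below the degree, `λ₂` has an eigenvector with entry sum `0`. -/
theorem IsRegularOfDegree.exists_eigenvector_secondEigenvalue {d : ℕ}
    (hreg : G.IsRegularOfDegree d) (hcard : 1 < Fintype.card V) (hlt : G.secondEigenvalue < d) :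
    ∃ x : V → ℝ, x ≠ 0 ∧ 1 ⬝ᵥ x = 0 ∧ G.adjMatrix ℝ *ᵥ x = G.secondEigenvalue • x := by
  obtain ⟨b, hb, hon, -⟩ := G.isHermitian_adjMatrix_real.exists_orthonormal_eigenvectors
  have h1 := hb ⟨1, hcard⟩
  rw [← secondEigenvalue_eq] at h1
  refine ⟨b ⟨1, hcard⟩, fun h0 => ?_, hreg.one_dotProduct_eq_zero h1 hlt.ne, h1⟩
  have := hon ⟨1, hcard⟩ ⟨1, hcard⟩
  simp [h0] at this

/-- In a regular graph with `λ₂` below the degree, `λ₂` bounds the quadratic form of the adjacency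
matrix on the vectors with entry sum `0`. -/
theorem IsRegularOfDegree.dotProduct_mulVec_le_of_sum_eq_zero {d : ℕ}
    (hreg : G.IsRegularOfDegree d) (hcard : 1 < Fintype.card V) (hlt : G.secondEigenvalue < d)
    {x : V → ℝ} (hx : 1 ⬝ᵥ x = 0) :
    x ⬝ᵥ G.adjMatrix ℝ *ᵥ x ≤ G.secondEigenvalue * (x ⬝ᵥ x) := by
  obtain ⟨b, hb, hon, hpars⟩ := G.isHermitian_adjMatrix_real.exists_orthonormal_eigenvectors
  set ev := G.isHermitian_adjMatrix_real.eigenvalues₀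
  let i₀ : Fin (Fintype.card V) := ⟨0, by omega⟩
  have hle : ∀ i, i ≠ i₀ → ev i ≤ G.secondEigenvalue := by
    intro i hi
    rw [secondEigenvalue_eq hcard]
    refine G.isHermitian_adjMatrix_real.eigenvalues₀_antitone ?_
    rw [Fin.le_def]
    have : (i : ℕ) ≠ 0 := fun h => hi (Fin.ext h)
    simp only
    omega
  -- Eigenvectors for eigenvalues below `d` are orthogonal to `1`. By Parseval `1` is then a
  -- multiple of `b i₀`, so a vector orthogonal to `1` has no `b i₀` component.
  have hperp : ∀ i, i ≠ i₀ → b i ⬝ᵥ 1 = 0 := fun i hi => by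
    rw [dotProduct_comm]
    exact hreg.one_dotProduct_eq_zero (hb i) ((hle i hi).trans_lt hlt).ne
  have hone : ∀ y : V → ℝ, 1 ⬝ᵥ y = (b i₀ ⬝ᵥ 1) * (b i₀ ⬝ᵥ y) := by
    intro y
    rw [hpars, Finset.sum_eq_single i₀ (fun i _ hi => by rw [hperp i hi, zero_mul]) (by simp)]
  have hne : b i₀ ⬝ᵥ 1 ≠ 0 := by
    intro h0
    have h1 := hone 1
    rw [h0, zero_mul] at h1
    simp at h1
    omega
  have hx0 : b i₀ ⬝ᵥ x = 0 := by
    have := hone x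
    rw [hx] at this
    exact (mul_eq_zero.mp this.symm).resolve_left hne
  rw [hpars x (_ *ᵥ x), hpars x x, Finset.mul_sum]
  refine Finset.sum_le_sum fun i _ => ?_
  rw [dotProduct_adjMatrix_mulVec_comm, hb, dotProduct_smul, smul_eq_mul, dotProduct_comm x (b i)]
  by_cases hi : i = i₀
  · simp [hi, hx0]
  · nlinarith [hle i hi, mul_self_nonneg (b i ⬝ᵥ x)]

/-- The Rayleigh inequality for arbitrary vectors, obtained by subtracting the mean. -/
theorem IsRegularOfDegree.card_mul_dotProduct_mulVec_le {d : ℕ}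
    (hreg : G.IsRegularOfDegree d) (hcard : 1 < Fintype.card V) {θ : ℝ}
    (hθ : G.secondEigenvalue ≤ θ) (hlt : θ < d) (y : V → ℝ) :
    Fintype.card V * (y ⬝ᵥ G.adjMatrix ℝ *ᵥ y) ≤
      θ * Fintype.card V * (y ⬝ᵥ y) + (d - θ) * (1 ⬝ᵥ y) ^ 2 := by
  have hn : (0 : ℝ) < Fintype.card V := by exact_mod_cast (by omega : 0 < Fintype.card V)
  set n : ℝ := (Fintype.card V : ℝ)
  set m : ℝ := (1 ⬝ᵥ y) / n with hm
  have hs : 1 ⬝ᵥ y = m * n := by rw [hm, div_mul_cancel₀ _ hn.ne']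
  have h11 : (1 : V → ℝ) ⬝ᵥ 1 = n := by simp [n]
  have hz : 1 ⬝ᵥ (y - m • 1) = 0 := by
    rw [dotProduct_sub, dotProduct_smul, h11, hs, smul_eq_mul, sub_self]
  have h := hreg.dotProduct_mulVec_le_of_sum_eq_zero hcard (hθ.trans_lt hlt) hz
  have hnn : 0 ≤ (y - m • 1) ⬝ᵥ (y - m • 1) :=
    Finset.sum_nonneg fun _ _ => mul_self_nonneg _
  have h' := h.trans (mul_le_mul_of_nonneg_right hθ hnn)
  have hy1 : y ⬝ᵥ 1 = m * n := by rw [dotProduct_comm, hs]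
  have hA1 : 1 ⬝ᵥ G.adjMatrix ℝ *ᵥ y = d * (m * n) := by
    rw [dotProduct_adjMatrix_mulVec_comm, hreg.adjMatrix_mulVec_one, dotProduct_smul, hy1,
      smul_eq_mul]
  simp only [mulVec_sub, mulVec_smul, hreg.adjMatrix_mulVec_one, dotProduct_sub, sub_dotProduct,
    dotProduct_smul, smul_dotProduct, smul_eq_mul, hy1, hs, h11, hA1] at h'
  rw [hs]
  nlinarith [mul_le_mul_of_nonneg_left h' hn.le]

/-- If at most one eigenvalue direction has an eigenvalue above `θ`, then `λ₂ ≤ θ`. -/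
theorem secondEigenvalue_le_of_eigenvectors_const (hcard : 1 < Fintype.card V) {θ : ℝ}
    (h : ∀ (μ : ℝ) (x : V → ℝ), θ < μ → G.adjMatrix ℝ *ᵥ x = μ • x → ∃ c : ℝ, x = c • 1) :
    G.secondEigenvalue ≤ θ := by
  by_contra! hlt
  obtain ⟨b, hb, hon, -⟩ := G.isHermitian_adjMatrix_real.exists_orthonormal_eigenvectors
  rw [secondEigenvalue_eq hcard] at hlt
  have hlt0 := hlt.trans_le (G.isHermitian_adjMatrix_real.eigenvalues₀_antitone
    (show (⟨0, by omega⟩ : Fin (Fintype.card V)) ≤ ⟨1, hcard⟩ by simp [Fin.le_def]))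
  obtain ⟨c, hc⟩ := h _ _ hlt (hb _)
  obtain ⟨c', hc'⟩ := h _ _ hlt0 (hb _)
  have h01 := hon ⟨0, by omega⟩ ⟨1, hcard⟩
  have h00 := hon ⟨0, by omega⟩ ⟨0, by omega⟩
  have h11 := hon ⟨1, hcard⟩ ⟨1, hcard⟩
  simp only [hc, hc', dotProduct_smul, smul_dotProduct, smul_eq_mul, Fin.mk.injEq, if_true,
    zero_ne_one, if_false] at h01 h00 h11
  rcases mul_eq_zero.mp h01 with h | h
  · simp [h] at h11
  · rcases mul_eq_zero.mp h with h | h <;> simp [h] at h00 h11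

end SimpleGraph

/-! ### Edge counts as values of the quadratic form. -/

namespace SimpleGraph

set_option linter.unusedSectionVars false

open Matrix Finset

variable {V : Type*} [Fintype V] [DecidableEq V] {G : SimpleGraph V} [DecidableRel G.Adj]

variable (G) in
/-- The number of pairs `(u, v)` of adjacent vertices with `u ∈ S` and `v ∈ T`, as a real number. -/
def edgeCount (S T : Finset V) : ℝ := ∑ u ∈ S, (#(G.neighborFinset u ∩ T) : ℝ)

theorem edgeCount_nonneg (S T : Finset V) : 0 ≤ G.edgeCount S T :=
  Finset.sum_nonneg fun _ _ => Nat.cast_nonneg _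

theorem card_mul_le_edgeCount {S T : Finset V} {k : ℕ}
    (h : ∀ u ∈ S, k ≤ #(G.neighborFinset u ∩ T)) : (#S : ℝ) * k ≤ G.edgeCount S T := by
  rw [edgeCount, ← nsmul_eq_mul]
  exact Finset.card_nsmul_le_sum _ _ _ fun u hu => by exact_mod_cast h u hu

theorem edgeCount_eq_zero {S T : Finset V} (h : ∀ u ∈ S, ∀ v ∈ T, ¬ G.Adj u v) :
    G.edgeCount S T = 0 := by
  refine Finset.sum_eq_zero fun u hu => ?_
  simp only [Nat.cast_eq_zero, Finset.card_eq_zero]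
  ext v
  simp only [mem_inter, mem_neighborFinset, notMem_empty, iff_false]
  exact fun hv => h u hu v hv.2 hv.1

theorem indicator_dotProduct_adjMatrix_mulVec (S T : Finset V) :
    Set.indicator (S : Set V) (1 : V → ℝ) ⬝ᵥ G.adjMatrix ℝ *ᵥ Set.indicator (T : Set V) 1 =
      G.edgeCount S T := by
  simp only [dotProduct, adjMatrix_mulVec_apply, edgeCount, Set.indicator_apply, Finset.mem_coe,
    Pi.one_apply, ite_mul, one_mul, zero_mul, Finset.sum_ite_mem, Finset.univ_inter,
    Finset.sum_const, nsmul_eq_mul, mul_one]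

theorem indicator_dotProduct_indicator (S T : Finset V) :
    Set.indicator (S : Set V) (1 : V → ℝ) ⬝ᵥ Set.indicator (T : Set V) 1 = #(S ∩ T) := by
  simp only [dotProduct, Set.indicator_apply, Finset.mem_coe,
    Pi.one_apply, ite_mul, one_mul, zero_mul, Finset.sum_ite_mem, Finset.univ_inter,
    Finset.sum_const, nsmul_eq_mul, mul_one]

theorem one_dotProduct_indicator (S : Finset V) :
    1 ⬝ᵥ Set.indicator (S : Set V) (1 : V → ℝ) = #S := by
  simp [dotProduct, Set.indicator_apply]

/-- The Rayleigh inequality for a vector that is constant on each of two disjoint sets and vanishes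
elsewhere. -/
theorem IsRegularOfDegree.card_mul_edgeCount_le {d : ℕ}
    (hreg : G.IsRegularOfDegree d) (hcard : 1 < Fintype.card V) {θ : ℝ}
    (hθ : G.secondEigenvalue ≤ θ) (hlt : θ < d) {S T : Finset V} (hST : Disjoint S T) (a b : ℝ) :
    Fintype.card V * (a ^ 2 * G.edgeCount S S + 2 * a * b * G.edgeCount S T
        + b ^ 2 * G.edgeCount T T) ≤
      θ * Fintype.card V * (a ^ 2 * #S + b ^ 2 * #T) + (d - θ) * (a * #S + b * #T) ^ 2 := by
  have h := hreg.card_mul_dotProduct_mulVec_le hcard hθ hlt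
    (a • Set.indicator (S : Set V) 1 + b • Set.indicator (T : Set V) 1)
  have hTS : G.edgeCount T S = G.edgeCount S T := by
    rw [← indicator_dotProduct_adjMatrix_mulVec, dotProduct_adjMatrix_mulVec_comm,
      indicator_dotProduct_adjMatrix_mulVec]
  have hd : S ∩ T = ∅ := Finset.disjoint_iff_inter_eq_empty.mp hST
  have hd' : T ∩ S = ∅ := by rw [Finset.inter_comm, hd]
  simp only [mulVec_add, mulVec_smul, dotProduct_add, add_dotProduct, dotProduct_smul,
    smul_dotProduct, smul_eq_mul, indicator_dotProduct_adjMatrix_mulVec,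
    indicator_dotProduct_indicator, one_dotProduct_indicator, Finset.inter_self, hd, hd', hTS,
    Finset.card_empty, Nat.cast_zero] at h
  linarith

/-! ### Short cycles and the upper bound on the order. -/

/-- Each vertex of `C` has at most one neighbour outside `C`. Hence `2k + 2` vertices leave two that
are neither in `C` nor adjacent to it. -/
theorem IsRegularOfDegree.card_biUnion_neighborFinset_le {k : ℕ} (hreg : G.IsRegularOfDegree 3)
    {C : Finset V} (hk : #C = k) (hC : ∀ u ∈ C, 2 ≤ #(G.neighborFinset u ∩ C)) :
    #(C ∪ C.biUnion fun u => G.neighborFinset u) ≤ 2 * k := by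
  have h1 : C ∪ (C.biUnion fun u => G.neighborFinset u) ⊆
      C ∪ C.biUnion (fun u => G.neighborFinset u \ C) := by
    intro v
    simp only [mem_union, mem_biUnion, mem_sdiff]
    by_cases hv : v ∈ C <;> simp [hv]
  refine (Finset.card_le_card h1).trans ((Finset.card_union_le _ _).trans ?_)
  have h2 : #(C.biUnion fun u => G.neighborFinset u \ C) ≤ #C * 1 := by
    refine Finset.card_biUnion_le_card_mul _ _ _ fun u hu => ?_
    have h3 := Finset.card_sdiff_add_card_inter (G.neighborFinset u) C
    rw [card_neighborFinset_eq_degree, hreg.degree_eq] at h3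
    have := hC u hu
    omega
  omega

/-- A cubic graph with a set `C` of minimum inner degree at least `2`, and with enough further
vertices, has a large second eigenvalue. -/
theorem IsRegularOfDegree.card_mul_le_of_two_le_inner_degree {k : ℕ}
    (hreg : G.IsRegularOfDegree 3) {θ : ℝ} (hθ : G.secondEigenvalue ≤ θ) (hlt : θ < 3)
    {C : Finset V} (hk : #C = k) (hC : ∀ u ∈ C, 2 ≤ #(G.neighborFinset u ∩ C))
    (hcard : 2 * k + 2 ≤ Fintype.card V) :
    Fintype.card V * (18 * k - (9 * k + 2) * θ) ≤ (3 - θ) * (3 * k - 2) ^ 2 := by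
  have h1 := hreg.card_biUnion_neighborFinset_le hk hC
  obtain ⟨R, hR, hR2⟩ := Finset.exists_subset_card_eq
    (s := (C ∪ C.biUnion fun u => G.neighborFinset u)ᶜ) (n := 2) (by rw [Finset.card_compl]; omega)
  have hR' : ∀ v ∈ R, v ∉ C ∧ ∀ u ∈ C, ¬ G.Adj u v := by
    intro v hv
    simpa using hR hv
  -- The weight `-1` on `R` lowers the mean at no cost, as no edge joins `C` to `R`.
  have h := hreg.card_mul_edgeCount_le (by omega) hθ (by exact_mod_cast hlt)
    (Finset.disjoint_right.mpr fun v hv => (hR' v hv).1) 3 (-1)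
  rw [edgeCount_eq_zero fun u hu v hv => (hR' v hv).2 u hu, hk, hR2] at h
  have h2 := card_mul_le_edgeCount hC
  rw [hk] at h2
  have h3 := G.edgeCount_nonneg R R
  push_cast at h h2
  have h4 : (Fintype.card V : ℝ) * (18 * k) ≤ Fintype.card V *
      (3 ^ 2 * G.edgeCount C C + 2 * 3 * -1 * 0 + (-1) ^ 2 * G.edgeCount R R) :=
    mul_le_mul_of_nonneg_left (by linarith) (Nat.cast_nonneg _)
  linarith

theorem two_le_card_neighborFinset_inter {C : Finset V} {u a b : V} (ha : a ∈ C) (hb : b ∈ C)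
    (hab : a ≠ b) (hua : G.Adj u a) (hub : G.Adj u b) : 2 ≤ #(G.neighborFinset u ∩ C) := by
  rw [← Finset.card_pair hab]
  refine Finset.card_le_card ?_
  simp [Finset.insert_subset_iff, *]

theorem sqrt_two_bounds : (1.414 : ℝ) < √2 ∧ √2 < 1.4143 :=
  ⟨Real.lt_sqrt_of_sq_lt (by norm_num), by rw [Real.sqrt_lt' (by norm_num)]; norm_num⟩

/-- For `k = 3, 4, 5` the preceding bound fails at `θ = √2`, `n = 2k + 2`, and fails for larger `n`
because `18k - (9k + 2)√2` is positive. -/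
theorem IsRegularOfDegree.no_triangle (hreg : G.IsRegularOfDegree 3)
    (hθ : G.secondEigenvalue ≤ √2) (hcard : 8 ≤ Fintype.card V) {a b c : V}
    (hab : G.Adj a b) (hbc : G.Adj b c) (hac : G.Adj a c) : False := by
  obtain ⟨hs, hs'⟩ := sqrt_two_bounds
  have h := hreg.card_mul_le_of_two_le_inner_degree hθ (by linarith) (C := {a, b, c}) (k := 3)
    (by rw [Finset.card_eq_three]; exact ⟨a, b, c, hab.ne, hac.ne, hbc.ne, rfl⟩)
    (by
      simp only [mem_insert, mem_singleton, forall_eq_or_imp, forall_eq]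
      exact ⟨two_le_card_neighborFinset_inter (by simp) (by simp) hbc.ne hab hac,
        two_le_card_neighborFinset_inter (by simp) (by simp) hac.ne hab.symm hbc,
        two_le_card_neighborFinset_inter (by simp) (by simp) hab.ne hac.symm hbc.symm⟩)
    (by omega)
  have hn : (8 : ℝ) ≤ Fintype.card V := by exact_mod_cast hcard
  push_cast at h
  nlinarith

theorem IsRegularOfDegree.no_four_cycle (hreg : G.IsRegularOfDegree 3)
    (hθ : G.secondEigenvalue ≤ √2) (hcard : 10 ≤ Fintype.card V) {x y m m' : V} (hxy : x ≠ y)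
    (hmx : G.Adj m x) (hmy : G.Adj m y) (hmx' : G.Adj m' x) (hmy' : G.Adj m' y) : m = m' := by
  by_contra hne
  obtain ⟨hs, hs'⟩ := sqrt_two_bounds
  have h := hreg.card_mul_le_of_two_le_inner_degree hθ (by linarith) (C := {x, y, m, m'}) (k := 4)
    (by
      rw [Finset.card_insert_of_notMem, Finset.card_insert_of_notMem, Finset.card_pair hne] <;>
        simp [hxy, hmx.ne', hmy.ne', hmx'.ne', hmy'.ne'])
    (by
      simp only [mem_insert, mem_singleton, forall_eq_or_imp, forall_eq]
      exact ⟨two_le_card_neighborFinset_inter (by simp) (by simp) hne hmx.symm hmx'.symm,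
        two_le_card_neighborFinset_inter (by simp) (by simp) hne hmy.symm hmy'.symm,
        two_le_card_neighborFinset_inter (by simp) (by simp) hxy hmx hmy,
        two_le_card_neighborFinset_inter (by simp) (by simp) hxy hmx' hmy'⟩)
    (by omega)
  have hn : (10 : ℝ) ≤ Fintype.card V := by exact_mod_cast hcard
  push_cast at h
  nlinarith

theorem IsRegularOfDegree.no_five_cycle (hreg : G.IsRegularOfDegree 3)
    (hθ : G.secondEigenvalue ≤ √2) (hcard : 12 ≤ Fintype.card V) {a b c d e : V}
    (hab : G.Adj a b) (hbc : G.Adj b c) (hcd : G.Adj c d) (hde : G.Adj d e) (hea : G.Adj e a) :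
    False := by
  have h3 : ∀ {a b c : V}, G.Adj a b → G.Adj b c → G.Adj a c → False :=
    fun h1 h2 h3 => hreg.no_triangle hθ (by omega) h1 h2 h3
  -- A closed walk of length five that repeats a vertex contains a triangle, so all closed 5-walks
  -- are excluded.
  have hac : a ≠ c := by rintro rfl; exact h3 hcd hde hea.symm
  have hbd : b ≠ d := by rintro rfl; exact h3 hde hea hab.symm
  have hce : c ≠ e := by rintro rfl; exact h3 hea hab hbc.symm
  have hda : d ≠ a := by rintro rfl; exact h3 hab hbc hcd.symm
  have heb : e ≠ b := by rintro rfl; exact h3 hbc hcd hde.symm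
  obtain ⟨hs, hs'⟩ := sqrt_two_bounds
  have h := hreg.card_mul_le_of_two_le_inner_degree hθ (by linarith) (C := {a, b, c, d, e}) (k := 5)
    (by
      rw [Finset.card_insert_of_notMem, Finset.card_insert_of_notMem,
        Finset.card_insert_of_notMem, Finset.card_pair hde.ne] <;>
        simp [hab.ne, hbc.ne, hcd.ne, hea.ne', hac, hbd, hce, hda.symm, heb.symm])
    (by
      simp only [mem_insert, mem_singleton, forall_eq_or_imp, forall_eq]
      exact ⟨two_le_card_neighborFinset_inter (by simp) (by simp) heb.symm hab hea.symm,
        two_le_card_neighborFinset_inter (by simp) (by simp) hac hab.symm hbc,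
        two_le_card_neighborFinset_inter (by simp) (by simp) hbd hbc.symm hcd,
        two_le_card_neighborFinset_inter (by simp) (by simp) hce hcd.symm hde,
        two_le_card_neighborFinset_inter (by simp) (by simp) hda hde.symm hea⟩)
    (by omega)
  have hn : (12 : ℝ) ≤ Fintype.card V := by exact_mod_cast hcard
  push_cast at h
  nlinarith

/-- A cubic graph on at least eight vertices with `λ₂ ≤ √2` has no complete bipartite subgraph
with parts of size `2` and `3`. -/
theorem IsRegularOfDegree.card_common_neighbors_le_two (hreg : G.IsRegularOfDegree 3)
    (hθ : G.secondEigenvalue ≤ √2) (hcard : 8 ≤ Fintype.card V) {u v : V} (huv : u ≠ v) :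
    #(G.neighborFinset u ∩ G.neighborFinset v) ≤ 2 := by
  by_contra! h
  obtain ⟨hs, hs'⟩ := sqrt_two_bounds
  have hdu : #(G.neighborFinset u) = 3 := by rw [card_neighborFinset_eq_degree, hreg.degree_eq]
  have hdv : #(G.neighborFinset v) = 3 := by rw [card_neighborFinset_eq_degree, hreg.degree_eq]
  have hu := Finset.eq_of_subset_of_card_le
    (Finset.inter_subset_left (s₁ := G.neighborFinset u) (s₂ := G.neighborFinset v)) (by omega)
  have hv := Finset.eq_of_subset_of_card_le
    (Finset.inter_subset_right (s₁ := G.neighborFinset u) (s₂ := G.neighborFinset v)) (by omega)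
  have huv' : G.neighborFinset u = G.neighborFinset v := hu.symm.trans hv
  have hdisj : Disjoint ({u, v} : Finset V) (G.neighborFinset u) := by
    rw [Finset.disjoint_left]
    simp only [mem_insert, mem_singleton, forall_eq_or_imp, forall_eq]
    exact ⟨by simp, by rw [huv']; simp⟩
  have hq := hreg.card_mul_edgeCount_le (by omega) hθ (by push_cast; linarith) hdisj 3 2
  have he : ((#({u, v} : Finset V) : ℕ) : ℝ) * (3 : ℕ) ≤
      G.edgeCount {u, v} (G.neighborFinset u) := by
    refine card_mul_le_edgeCount ?_
    simp only [mem_insert, mem_singleton, forall_eq_or_imp, forall_eq, ← huv', Finset.inter_self,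
      hdu, le_refl, and_self]
  rw [Finset.card_pair huv] at hq he
  rw [hdu] at hq
  have h1 := G.edgeCount_nonneg {u, v} {u, v}
  have h2 := G.edgeCount_nonneg (G.neighborFinset u) (G.neighborFinset u)
  have hn : (8 : ℝ) ≤ Fintype.card V := by exact_mod_cast hcard
  push_cast at hq he
  have h4 : (Fintype.card V : ℝ) * 72 ≤ Fintype.card V *
      (3 ^ 2 * G.edgeCount {u, v} {u, v} + 2 * 3 * 2 * G.edgeCount {u, v} (G.neighborFinset u)
        + 2 ^ 2 * G.edgeCount (G.neighborFinset u) (G.neighborFinset u)) :=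
    mul_le_mul_of_nonneg_left (by linarith) (Nat.cast_nonneg _)
  nlinarith

/-- The test vector is `5` on the ends of an edge and `2` on their four other neighbours. Up to a
constant shift, it approximates a `√2`-eigenvector of the Heawood graph depending only on the
distance to an edge; it rules out order 16 and narrowly fails to rule out 14. -/
theorem IsRegularOfDegree.card_lt_sixteen (hreg : G.IsRegularOfDegree 3)
    (hθ : G.secondEigenvalue ≤ √2) : Fintype.card V < 16 := by
  by_contra! hcard
  obtain ⟨hs, hs'⟩ := sqrt_two_bounds
  have hdeg : ∀ w, #(G.neighborFinset w) = 3 := fun w => by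
    rw [card_neighborFinset_eq_degree, hreg.degree_eq]
  obtain ⟨u⟩ : Nonempty V := Fintype.card_pos_iff.mp (by omega)
  obtain ⟨v, hv⟩ : (G.neighborFinset u).Nonempty := by rw [← Finset.card_pos, hdeg]; simp
  rw [mem_neighborFinset] at hv
  set T := (G.neighborFinset u).erase v ∪ (G.neighborFinset v).erase u with hT
  have hdisjT : Disjoint ((G.neighborFinset u).erase v) ((G.neighborFinset v).erase u) := by
    rw [Finset.disjoint_left]
    intro w h1 h2
    simp only [mem_erase, mem_neighborFinset] at h1 h2
    exact hreg.no_triangle hθ (by omega) hv h2.2 h1.2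
  have hTcard : #T = 4 := by
    rw [hT, Finset.card_union_of_disjoint hdisjT, Finset.card_erase_of_mem (by simpa using hv),
      Finset.card_erase_of_mem (by simpa using hv.symm), hdeg, hdeg]
  have hdisj : Disjoint ({u, v} : Finset V) T := by
    rw [Finset.disjoint_left]
    simp [hT]
  have hq := hreg.card_mul_edgeCount_le (by omega) hθ (by push_cast; linarith) hdisj 5 2
  have he : ((#({u, v} : Finset V) : ℕ) : ℝ) * (2 : ℕ) ≤ G.edgeCount {u, v} T := by
    refine card_mul_le_edgeCount ?_
    simp only [mem_insert, mem_singleton, forall_eq_or_imp, forall_eq]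
    have h1 := Finset.card_erase_of_mem (s := G.neighborFinset u) (a := v) (by simpa using hv)
    have h2 := Finset.card_erase_of_mem (s := G.neighborFinset v) (a := u) (by simpa using hv.symm)
    rw [hdeg] at h1 h2
    refine ⟨h1.ge.trans (Finset.card_le_card ?_), h2.ge.trans (Finset.card_le_card ?_)⟩
    · exact Finset.subset_inter (Finset.erase_subset _ _) Finset.subset_union_left
    · exact Finset.subset_inter (Finset.erase_subset _ _) Finset.subset_union_right
  have he' : ((#({u, v} : Finset V) : ℕ) : ℝ) * (1 : ℕ) ≤ G.edgeCount {u, v} {u, v} := by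
    refine card_mul_le_edgeCount ?_
    simp only [mem_insert, mem_singleton, forall_eq_or_imp, forall_eq, Nat.one_le_iff_ne_zero,
      ← Nat.pos_iff_ne_zero, Finset.card_pos]
    exact ⟨⟨v, by simpa using hv⟩, ⟨u, by simpa using hv.symm⟩⟩
  rw [Finset.card_pair hv.ne] at hq he he'
  rw [hTcard] at hq
  have h2 := G.edgeCount_nonneg T T
  have hn : (16 : ℝ) ≤ Fintype.card V := by exact_mod_cast hcard
  push_cast at hq he he'
  -- Edges are counted as ordered pairs: `130 = 25 · 2 + 20 · 4`.
  have h4 : (Fintype.card V : ℝ) * 130 ≤ Fintype.card V *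
      (5 ^ 2 * G.edgeCount {u, v} {u, v} + 2 * 5 * 2 * G.edgeCount {u, v} T
        + 2 ^ 2 * G.edgeCount T T) :=
    mul_le_mul_of_nonneg_left (by linarith) (Nat.cast_nonneg _)
  nlinarith

/-! ### Orders below twelve. -/

/-- An eigenvalue of a matrix with nonnegative entries is bounded by its constant row sum. -/
theorem _root_.Matrix.abs_le_of_mulVec_eq_smul {W : Matrix V V ℝ} {r μ : ℝ} {x : V → ℝ}
    (hx : x ≠ 0) (h0 : ∀ i j, 0 ≤ W i j) (h1 : ∀ i, ∑ j, W i j = r) (hμ : W *ᵥ x = μ • x) :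
    |μ| ≤ r := by
  obtain ⟨j, hj⟩ := Function.ne_iff.mp hx
  obtain ⟨i, -, hi⟩ := Finset.exists_max_image Finset.univ (fun v => |x v|) ⟨j, Finset.mem_univ _⟩
  have hpos : 0 < |x i| := (abs_pos.mpr hj).trans_le (hi j (Finset.mem_univ _))
  refine le_of_mul_le_mul_right ?_ hpos
  calc |μ| * |x i| = |∑ j, W i j * x j| := by
        rw [← abs_mul]
        exact congrArg abs (congrFun hμ i).symm
    _ ≤ ∑ j, |W i j * x j| := Finset.abs_sum_le_sum_abs _ _
    _ ≤ ∑ j, W i j * |x i| := Finset.sum_le_sum fun j _ => by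
        rw [abs_mul, abs_of_nonneg (h0 i j)]
        exact mul_le_mul_of_nonneg_left (hi j (Finset.mem_univ _)) (h0 i j)
    _ = r * |x i| := by rw [← Finset.sum_mul, h1]

theorem adjMatrix_mul_self_apply_eq_card (u v : V) :
    (G.adjMatrix ℝ * G.adjMatrix ℝ) u v = #(G.neighborFinset u ∩ G.neighborFinset v) := by
  rw [adjMatrix_mul_apply]
  simp only [adjMatrix_apply, Finset.sum_boole, Nat.cast_inj]
  congr 1
  ext w
  simp [adj_comm]

/-- If a combination of `J`, `I`, `A` and `A²` has nonnegative entries, then its row sum bounds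
the corresponding polynomial in `λ₂`. -/
theorem IsRegularOfDegree.quadratic_secondEigenvalue_le {d : ℕ} (hreg : G.IsRegularOfDegree d)
    (hcard : 1 < Fintype.card V) (hlt : G.secondEigenvalue < d) (c q t r : ℝ)
    (h : ∀ u v, 0 ≤ c + (if u = v then q else 0) - (if G.Adj u v then t else 0)
      - r * #(G.neighborFinset u ∩ G.neighborFinset v)) :
    r * G.secondEigenvalue ^ 2 + t * G.secondEigenvalue - q ≤
      c * Fintype.card V + q - t * d - r * d ^ 2 := by
  obtain ⟨x, hx, hx1, hAx⟩ := hreg.exists_eigenvector_secondEigenvalue hcard hlt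
  set s := G.secondEigenvalue
  set A := G.adjMatrix ℝ
  set W : Matrix V V ℝ := c • Matrix.of (fun _ _ => 1) + q • 1 - t • A - r • (A * A) with hW
  have hJ : ∀ y : V → ℝ, Matrix.of (fun _ _ : V => (1 : ℝ)) *ᵥ y = (1 ⬝ᵥ y) • 1 := by
    intro y
    ext v
    simp [mulVec, dotProduct]
  have hWx : W *ᵥ x = (-(r * s ^ 2 + t * s - q)) • x := by
    rw [hW, sub_mulVec, sub_mulVec, add_mulVec, smul_mulVec, smul_mulVec, smul_mulVec, smul_mulVec,
      ← mulVec_mulVec, hAx, mulVec_smul, hAx, hJ, hx1, one_mulVec]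
    ext v
    simp
    ring
  have hW1 : W *ᵥ 1 = (c * Fintype.card V + q - t * d - r * d ^ 2) • 1 := by
    rw [hW, sub_mulVec, sub_mulVec, add_mulVec, smul_mulVec, smul_mulVec, smul_mulVec, smul_mulVec,
      ← mulVec_mulVec, hreg.adjMatrix_mulVec_one, mulVec_smul, hreg.adjMatrix_mulVec_one, hJ,
      one_mulVec, one_dotProduct_one]
    ext v
    simp only [Pi.add_apply, Pi.sub_apply, Pi.smul_apply, smul_eq_mul, Pi.one_apply]
    ring
  have hle := Matrix.abs_le_of_mulVec_eq_smul hx (W := W)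
    (r := c * Fintype.card V + q - t * d - r * d ^ 2)
    (fun u v => by
      have := h u v
      simp only [hW, Matrix.sub_apply, Matrix.add_apply, Matrix.smul_apply, Matrix.of_apply,
        smul_eq_mul, mul_one, Matrix.one_apply, A, adjMatrix_mul_self_apply_eq_card,
        adjMatrix_apply, mul_ite, mul_zero]
      exact this)
    (fun i => by simpa [mulVec, dotProduct] using congrFun hW1 i) hWx
  rw [abs_neg] at hle
  exact (le_abs_self _).trans hle

theorem IsRegularOfDegree.even_card (hreg : G.IsRegularOfDegree 3) :
    Fintype.card V % 2 = 0 := by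
  have := G.sum_degrees_eq_twice_card_edges
  simp only [hreg.degree_eq, Finset.sum_const, Finset.card_univ, smul_eq_mul] at this
  omega

/-- A cubic graph with `1 < λ₂ ≤ √2` has at least twelve vertices. -/
theorem IsRegularOfDegree.twelve_le_card (hreg : G.IsRegularOfDegree 3)
    (h1 : 1 < G.secondEigenvalue) (hθ : G.secondEigenvalue ≤ √2) : 12 ≤ Fintype.card V := by
  obtain ⟨hs, hs'⟩ := sqrt_two_bounds
  have hdeg : ∀ w, #(G.neighborFinset w) = 3 := fun w => by
    rw [card_neighborFinset_eq_degree, hreg.degree_eq]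
  have hcard : 1 < Fintype.card V := by
    by_contra hc
    rw [secondEigenvalue, dif_neg hc] at h1
    linarith
  have heven := hreg.even_card
  have hlt : G.secondEigenvalue < (3 : ℕ) := by push_cast; linarith
  have key := hreg.quadratic_secondEigenvalue_le hcard hlt
  by_contra! hn
  obtain h6 | h8 | h10 : Fintype.card V ≤ 6 ∨ Fintype.card V = 8 ∨ Fintype.card V = 10 := by omega
  -- `J - I - A` is the adjacency matrix of the complement; this gives `λ₂ + 1 ≤ n - 4`.
  · have := key 1 (-1) 1 0 fun u v => by
      by_cases huv : u = v
      · simp [huv]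
      · by_cases ha : G.Adj u v <;> simp [huv, ha]
    have h6' : (Fintype.card V : ℝ) ≤ 6 := by exact_mod_cast h6
    push_cast at this
    linarith
  -- `2J + I - 2A - A²` vanishes on the diagonal and, without triangles, on edges; elsewhere two
  -- vertices have at most two common neighbours. The bound reads `(λ₂ - 1)(λ₂ + 3) ≤ 0`.
  · have := key 2 1 2 1 fun u v => by
      by_cases huv : u = v
      · subst huv
        simp [hdeg]
        norm_num
      · have h2 := hreg.card_common_neighbors_le_two hθ (by omega) huv
        by_cases ha : G.Adj u v
        · have : G.neighborFinset u ∩ G.neighborFinset v = ∅ := by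
            ext w
            simp only [mem_inter, mem_neighborFinset, notMem_empty, iff_false]
            exact fun h => hreg.no_triangle hθ (by omega) ha h.2 h.1
          simp [huv, ha, this]
        · simp [huv, ha]
          exact_mod_cast h2
    rw [h8] at this
    push_cast at this
    nlinarith
  -- `J + 2I - A - A²` is nonnegative for girth at least five, and the bound reads `(λ₂ - 1)(λ₂ + 2)
  -- ≤ 0`.
  · have := key 1 2 1 1 fun u v => by
      by_cases huv : u = v
      · subst huv
        simp [hdeg]
        norm_num
      · have h2 : #(G.neighborFinset u ∩ G.neighborFinset v) ≤ 1 := by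
          rw [Finset.card_le_one]
          intro a ha b hb
          simp only [mem_inter, mem_neighborFinset] at ha hb
          exact hreg.no_four_cycle hθ (by omega) huv ha.1.symm ha.2.symm hb.1.symm hb.2.symm
        by_cases ha : G.Adj u v
        · have : G.neighborFinset u ∩ G.neighborFinset v = ∅ := by
            ext w
            simp only [mem_inter, mem_neighborFinset, notMem_empty, iff_false]
            exact fun h => hreg.no_triangle hθ (by omega) ha h.2 h.1
          simp [huv, ha, this]
        · simp [huv, ha]
          exact_mod_cast h2
    rw [h10] at this
    push_cast at this
    nlinarith

/-! ### Cubic graphs of girth six on fourteen vertices. -/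

/-- An injective homomorphism between regular graphs of the same degree and order is an
isomorphism. -/
theorem IsRegularOfDegree.nonempty_iso_of_injective_hom {W : Type*} [Fintype W] [DecidableEq W]
    {H : SimpleGraph W} [DecidableRel H.Adj] {d : ℕ} (hG : G.IsRegularOfDegree d)
    (hH : H.IsRegularOfDegree d) (hcard : Fintype.card W = Fintype.card V) (f : H →g G)
    (hf : Function.Injective f) : Nonempty (G ≃g H) := by
  have himg : ∀ w, (H.neighborFinset w).image f = G.neighborFinset (f w) := by
    intro w
    refine Finset.eq_of_subset_of_card_le ?_ ?_
    · intro v hv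
      obtain ⟨w', hw', rfl⟩ := Finset.mem_image.mp hv
      simpa using f.map_adj (by simpa using hw')
    · rw [Finset.card_image_of_injective _ hf, card_neighborFinset_eq_degree,
        card_neighborFinset_eq_degree, hG.degree_eq, hH.degree_eq]
  let e := Equiv.ofBijective f ((Fintype.bijective_iff_injective_and_card f).mpr ⟨hf, hcard⟩)
  refine ⟨RelIso.symm ⟨e, fun {a b} => ?_⟩⟩
  change G.Adj (f a) (f b) ↔ H.Adj a b
  refine ⟨fun h => ?_, f.map_adj⟩
  rw [← mem_neighborFinset, ← himg, Finset.mem_image] at h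
  obtain ⟨c, hc, hcb⟩ := h
  rw [← hf hcb]
  simpa using hc

theorem IsRegularOfDegree.exists_neighbors (hreg : G.IsRegularOfDegree 3) (x : V) :
    ∃ a b c, a ≠ b ∧ a ≠ c ∧ b ≠ c ∧ ∀ y, G.Adj x y ↔ y = a ∨ y = b ∨ y = c := by
  have h : #(G.neighborFinset x) = 3 := by rw [card_neighborFinset_eq_degree, hreg.degree_eq]
  obtain ⟨a, b, c, hab, hac, hbc, h⟩ := Finset.card_eq_three.mp h
  refine ⟨a, b, c, hab, hac, hbc, fun y => ?_⟩
  rw [← mem_neighborFinset, h]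
  simp

theorem IsRegularOfDegree.exists_third_neighbor (hreg : G.IsRegularOfDegree 3) {x a b : V}
    (ha : G.Adj x a) (hb : G.Adj x b) (hab : a ≠ b) :
    ∃ c, c ≠ a ∧ c ≠ b ∧ ∀ y, G.Adj x y ↔ y = a ∨ y = b ∨ y = c := by
  obtain ⟨p, q, r, hpq, hpr, hqr, h⟩ := hreg.exists_neighbors x
  rw [h] at ha hb
  rcases ha with rfl | rfl | rfl <;> rcases hb with rfl | rfl | rfl <;>
    first
    | exact absurd rfl hab
    | exact ⟨r, by grind, by grind, fun y => by grind⟩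
    | exact ⟨q, by grind, by grind, fun y => by grind⟩
    | exact ⟨p, by grind, by grind, fun y => by grind⟩

theorem IsRegularOfDegree.exists_other_neighbors (hreg : G.IsRegularOfDegree 3) {x a : V}
    (ha : G.Adj x a) :
    ∃ b c, b ≠ a ∧ c ≠ a ∧ b ≠ c ∧ ∀ y, G.Adj x y ↔ y = a ∨ y = b ∨ y = c := by
  obtain ⟨p, q, r, hpq, hpr, hqr, h⟩ := hreg.exists_neighbors x
  rw [h] at ha
  rcases ha with rfl | rfl | rfl
  · exact ⟨q, r, by tauto, by tauto, by tauto, h⟩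
  · exact ⟨p, r, by tauto, by grind, by grind, fun y => by grind⟩
  · exact ⟨p, q, by tauto, by grind, by grind, fun y => by grind⟩

variable (G) in
/-- The vertices joined to `u` by a walk of length two (including `u` itself). -/
def twoStep (u : V) : Finset V := (G.neighborFinset u).biUnion fun z => G.neighborFinset z

theorem mem_twoStep {u x : V} : x ∈ G.twoStep u ↔ ∃ z, G.Adj u z ∧ G.Adj z x := by
  simp [twoStep]

theorem mem_twoStep_comm {u x : V} : x ∈ G.twoStep u ↔ u ∈ G.twoStep x := by
  simp only [mem_twoStep, adj_comm, and_comm]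

/-- Without 4-cycles the `3 · 2` non-backtracking walks of length two end at distinct vertices; `u`
is the seventh. -/
theorem IsRegularOfDegree.seven_le_card_twoStep (hreg : G.IsRegularOfDegree 3)
    (h4 : ∀ {x y m m' : V}, x ≠ y → G.Adj m x → G.Adj m y → G.Adj m' x → G.Adj m' y → m = m')
    (u : V) : 7 ≤ #(G.twoStep u) := by
  have hdeg : ∀ w, #(G.neighborFinset w) = 3 := fun w => by
    rw [card_neighborFinset_eq_degree, hreg.degree_eq]
  set S := (G.neighborFinset u).biUnion fun z => (G.neighborFinset z).erase u with hS
  have hcard : #S = 6 := by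
    rw [hS, Finset.card_biUnion, Finset.sum_congr rfl (g := fun _ => 2)]
    · simp [hdeg]
    · intro z hz
      rw [Finset.card_erase_of_mem (by simpa [adj_comm] using hz), hdeg]
    · intro z hz z' hz' hne
      refine Finset.disjoint_left.mpr fun w hw hw' => ?_
      simp only [mem_coe, mem_neighborFinset, mem_erase] at hz hz' hw hw'
      exact hne (h4 hw.1 hw.2 hz.symm hw'.2 hz'.symm)
  have hu : u ∉ S := by simp [hS]
  rw [show 7 = #(insert u S) by rw [Finset.card_insert_of_notMem hu, hcard]]
  refine Finset.card_le_card ?_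
  intro w hw
  rw [mem_twoStep]
  rcases Finset.mem_insert.mp hw with rfl | hw
  · obtain ⟨z, hz⟩ : (G.neighborFinset w).Nonempty := by rw [← Finset.card_pos, hdeg]; simp
    rw [mem_neighborFinset] at hz
    exact ⟨z, hz, hz.symm⟩
  · simp only [hS, mem_biUnion, mem_neighborFinset, mem_erase] at hw
    obtain ⟨z, hz, -, hzw⟩ := hw
    exact ⟨z, hz, hzw⟩

theorem disjoint_twoStep
    (h5 : ∀ {a b c d e : V}, G.Adj a b → G.Adj b c → G.Adj c d → G.Adj d e → G.Adj e a → False)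
    {u v : V} (huv : G.Adj u v) : Disjoint (G.twoStep u) (G.twoStep v) := by
  rw [Finset.disjoint_left]
  intro x hu hv
  rw [mem_twoStep] at hu hv
  obtain ⟨z, h1, h2⟩ := hu
  obtain ⟨w, h3, h6⟩ := hv
  exact h5 h1 h2 h6.symm h3.symm huv.symm

theorem IsRegularOfDegree.fourteen_le_card [Nonempty V] (hreg : G.IsRegularOfDegree 3)
    (h4 : ∀ {x y m m' : V}, x ≠ y → G.Adj m x → G.Adj m y → G.Adj m' x → G.Adj m' y → m = m')
    (h5 : ∀ {a b c d e : V}, G.Adj a b → G.Adj b c → G.Adj c d → G.Adj d e → G.Adj e a → False) :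
    14 ≤ Fintype.card V := by
  obtain ⟨u⟩ := ‹Nonempty V›
  obtain ⟨v, _, _, -, -, -, h⟩ := hreg.exists_neighbors u
  have huv : G.Adj u v := by simp [h]
  have := Finset.card_le_univ (G.twoStep u ∪ G.twoStep v)
  rw [Finset.card_union_of_disjoint (disjoint_twoStep h5 huv)] at this
  have h1 := hreg.seven_le_card_twoStep h4 u
  have h2 := hreg.seven_le_card_twoStep h4 v
  omega

/-- Two disjoint sets of at least seven vertices fill all fourteen. This is the bipartition, in the
form used below: crossing an edge switches the class. -/
theorem IsRegularOfDegree.mem_twoStep_iff_of_adj (hreg : G.IsRegularOfDegree 3)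
    (h4 : ∀ {x y m m' : V}, x ≠ y → G.Adj m x → G.Adj m y → G.Adj m' x → G.Adj m' y → m = m')
    (h5 : ∀ {a b c d e : V}, G.Adj a b → G.Adj b c → G.Adj c d → G.Adj d e → G.Adj e a → False)
    (hcard : Fintype.card V = 14) {u v : V} (huv : G.Adj u v) (x : V) :
    x ∈ G.twoStep u ↔ x ∉ G.twoStep v := by
  refine ⟨fun h => Finset.disjoint_left.mp (disjoint_twoStep h5 huv) h, fun h => ?_⟩
  have hun : G.twoStep u ∪ G.twoStep v = Finset.univ := by
    refine Finset.eq_univ_of_card _ (le_antisymm (Finset.card_le_univ _) ?_)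
    rw [Finset.card_union_of_disjoint (disjoint_twoStep h5 huv), hcard]
    have h1 := hreg.seven_le_card_twoStep h4 u
    have h2 := hreg.seven_le_card_twoStep h4 v
    omega
  have hx := Finset.mem_univ x
  rw [← hun, Finset.mem_union] at hx
  exact hx.resolve_right h

/-- Two vertices at distance two from `P`, on different neighbours of `P`, have a common neighbour,
and that neighbour is joined to the third neighbour of `P` by a path of length two. -/
theorem IsRegularOfDegree.exists_join (hreg : G.IsRegularOfDegree 3)
    (h4 : ∀ {x y m m' : V}, x ≠ y → G.Adj m x → G.Adj m y → G.Adj m' x → G.Adj m' y → m = m')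
    (hxor : ∀ {u v : V}, G.Adj u v → ∀ x, x ∈ G.twoStep u ↔ x ∉ G.twoStep v)
    {P α β γ x y : V}
    (hαβ : α ≠ β) (hP : ∀ w, G.Adj P w ↔ w = α ∨ w = β ∨ w = γ)
    (hx : G.Adj α x) (hy : G.Adj β y) (hxP : x ≠ P) (hyP : y ≠ P) :
    ∃ L c, G.Adj L x ∧ G.Adj L y ∧ G.Adj L c ∧ G.Adj γ c ∧ c ≠ P ∧ c ≠ x ∧ c ≠ y := by
  have hα : G.Adj P α := by simp [hP]
  have hβ : G.Adj P β := by simp [hP]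
  have hPx : x ∈ G.twoStep P := mem_twoStep.mpr ⟨α, hα, hx⟩
  have hPy : y ∈ G.twoStep P := mem_twoStep.mpr ⟨β, hβ, hy⟩
  have hxy : x ≠ y := by
    rintro rfl
    exact hαβ (h4 hxP hx hα.symm hy hβ.symm)
  -- The path `P`, `α`, `x` switches classes twice, so `x` is in the class of `P` and has a common
  -- neighbour with `y`.
  have hxy2 : y ∈ G.twoStep x := (hxor hx.symm y).mpr ((hxor hα y).mp hPy)
  obtain ⟨L, hxL, hLy⟩ := mem_twoStep.mp hxy2
  have hLα : L ≠ α := by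
    rintro rfl
    exact hαβ (h4 hyP hLy hα.symm hy hβ.symm)
  have hLβ : L ≠ β := by
    rintro rfl
    exact hαβ (h4 hxP hx hα.symm hxL.symm hβ.symm)
  obtain ⟨c, hcx, hcy, hL⟩ := hreg.exists_third_neighbor hxL.symm hLy hxy
  have hLc : G.Adj L c := by simp [hL]
  have hPc : P ∈ G.twoStep c :=
    (hxor hLc.symm P).mpr ((hxor hxL P).mp (mem_twoStep_comm.mp hPx))
  obtain ⟨m, hcm, hmP⟩ := mem_twoStep.mp hPc
  have hcP : c ≠ P := by
    rintro rfl
    exact hLα (h4 hcx hLc hxL.symm hα.symm hx)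
  refine ⟨L, c, hxL.symm, hLy, hLc, ?_, hcP, hcx, hcy⟩
  -- If `c` were on `α` or `β`, that line would share two points with `L` and equal it.
  rcases (hP m).mp hmP.symm with rfl | rfl | rfl
  · exact absurd (h4 hcx hLc hxL.symm hcm.symm hx) hLα
  · exact absurd (h4 hcy hLc hLy hcm.symm hy) hLβ
  · exact hcm.symm

/-- The points and lines of the Fano plane can be found in a cubic graph of girth six on fourteen
vertices. -/
theorem IsRegularOfDegree.exists_fano_labelling [Nonempty V] (hreg : G.IsRegularOfDegree 3)
    (h4 : ∀ {x y m m' : V}, x ≠ y → G.Adj m x → G.Adj m y → G.Adj m' x → G.Adj m' y → m = m')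
    (hxor : ∀ {u v : V}, G.Adj u v → ∀ x, x ∈ G.twoStep u ↔ x ∉ G.twoStep v) :
    ∃ P p₁ p₂ p₃ p₁₂ p₁₃ p₂₃ α β γ L₁ L₂ L₃ L₄ : V,
      (G.Adj P α ∧ G.Adj P β ∧ G.Adj P γ) ∧ (G.Adj p₃ α ∧ G.Adj p₁₂ α) ∧
      (G.Adj p₂ β ∧ G.Adj p₁₃ β) ∧ (G.Adj p₁ γ ∧ G.Adj p₂₃ γ) ∧
      (G.Adj p₂ L₁ ∧ G.Adj p₃ L₁ ∧ G.Adj p₂₃ L₁) ∧ (G.Adj p₁ L₂ ∧ G.Adj p₃ L₂ ∧ G.Adj p₁₃ L₂) ∧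
      (G.Adj p₁ L₃ ∧ G.Adj p₂ L₃ ∧ G.Adj p₁₂ L₃) ∧
      (G.Adj p₁₂ L₄ ∧ G.Adj p₁₃ L₄ ∧ G.Adj p₂₃ L₄) ∧
      [p₁, p₂, p₁₂, p₃, p₁₃, p₂₃, P].Nodup := by
  obtain ⟨P⟩ := ‹Nonempty V›
  obtain ⟨α, β, γ, hαβ, hαγ, hβγ, hP⟩ := hreg.exists_neighbors P
  have hα : G.Adj P α := by simp [hP]
  have hβ : G.Adj P β := by simp [hP]
  have hγ : G.Adj P γ := by simp [hP]
  have cross : ∀ {a b x : V}, G.Adj P a → G.Adj P b → a ≠ b → G.Adj a x → G.Adj b x → x = P :=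
    fun ha hb hab hax hbx => by
      by_contra hx
      exact hab (h4 hx hax ha.symm hbx hb.symm)
  -- With `P` as `111`, the points `p₃` on `α` and `p₂` on `β` are free choices. The other points
  -- arise as third points on lines.
  obtain ⟨p₃, _, hp₃P, -, -, hαN⟩ := hreg.exists_other_neighbors hα.symm
  obtain ⟨p₂, _, hp₂P, -, -, hβN⟩ := hreg.exists_other_neighbors hβ.symm
  have hp₃ : G.Adj α p₃ := by simp [hαN]
  have hp₂ : G.Adj β p₂ := by simp [hβN]
  obtain ⟨L₁, p₂₃, h13, h12, h123, hp₂₃, hp₂₃P, -, -⟩ :=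
    hreg.exists_join h4 hxor hαβ hP hp₃ hp₂ hp₃P hp₂P
  obtain ⟨p₁, hp₁P, hp₁₂₃, hγN⟩ := hreg.exists_third_neighbor hγ.symm hp₂₃ hp₂₃P.symm
  have hp₁ : G.Adj γ p₁ := by simp [hγN]
  obtain ⟨L₂, p₁₃, h21, h23, h213, hp₁₃, hp₁₃P, -, -⟩ :=
    hreg.exists_join h4 hxor (β := α) (γ := β) hαγ.symm (fun w => by rw [hP]; tauto)
      hp₁ hp₃ hp₁P hp₃P
  obtain ⟨L₃, p₁₂, h31, h32, h312, hp₁₂, hp₁₂P, -, -⟩ :=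
    hreg.exists_join h4 hxor (β := β) (γ := α) hβγ.symm (fun w => by rw [hP]; tauto)
      hp₁ hp₂ hp₁P hp₂P
  obtain ⟨L₄, c, h412, h413, h4c, hc, hcP, -, -⟩ :=
    hreg.exists_join h4 hxor hαβ hP hp₁₂ hp₁₃ hp₁₂P hp₁₃P
  have n12 : p₁ ≠ p₂ := by
    rintro rfl
    exact hp₁P (cross hγ hβ hβγ.symm hp₁ hp₂)
  have n13 : p₁ ≠ p₃ := by
    rintro rfl
    exact hp₁P (cross hγ hα hαγ.symm hp₁ hp₃)
  have n23 : p₂ ≠ p₃ := by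
    rintro rfl
    exact hp₂P (cross hβ hα hαβ.symm hp₂ hp₃)
  have hp₁L₁ : ¬ G.Adj L₁ p₁ := by
    intro h
    obtain rfl : L₁ = γ := h4 hp₁₂₃ h h123 hp₁ hp₂₃
    exact hp₂P (cross hγ hβ hβγ.symm h12 hp₂)
  have hp₁₃₂ : p₁₃ ≠ p₂ := by
    rintro rfl
    obtain rfl : L₂ = L₁ := h4 n23 h213 h23 h12 h13
    exact hp₁L₁ h21
  have hp₁₂₃' : p₁₂ ≠ p₃ := by
    rintro rfl
    obtain rfl : L₃ = L₁ := h4 n23 h32 h312 h12 h13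
    exact hp₁L₁ h31
  have n1_13 : p₁ ≠ p₁₃ := by
    rintro rfl
    exact hp₁P (cross hγ hβ hβγ.symm hp₁ hp₁₃)
  -- The diagonal points are collinear: the only alternative on `γ` is `p₁`, which would force `L₄ =
  -- L₂` and then `L₄ = α`.
  have hc23 : c = p₂₃ := by
    rcases (hγN c).mp hc with h | h | h
    · exact absurd h hcP
    · exact h
    · subst h
      obtain rfl : L₄ = L₂ := h4 n1_13 h4c h413 h21 h213
      obtain rfl : L₄ = α := h4 hp₁₂₃' h412 h23 hp₁₂ hp₃
      exact absurd (cross hγ hα hαγ.symm hp₁ h4c) hp₁P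
  subst hc23
  refine ⟨P, p₁, p₂, p₃, p₁₂, p₁₃, c, α, β, γ, L₁, L₂, L₃, L₄, ⟨hα, hβ, hγ⟩,
    ⟨hp₃.symm, hp₁₂.symm⟩, ⟨hp₂.symm, hp₁₃.symm⟩, ⟨hp₁.symm, hp₂₃.symm⟩,
    ⟨h12.symm, h13.symm, h123.symm⟩, ⟨h21.symm, h23.symm, h213.symm⟩,
    ⟨h31.symm, h32.symm, h312.symm⟩, ⟨h412.symm, h413.symm, h4c.symm⟩, ?_⟩
  have nαβ : ∀ {x y}, G.Adj α x → G.Adj β y → x ≠ P → x ≠ y := by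
    rintro x _ h1 h2 h3 rfl
    exact h3 (cross hα hβ hαβ h1 h2)
  have nαγ : ∀ {x y}, G.Adj α x → G.Adj γ y → x ≠ P → x ≠ y := by
    rintro x _ h1 h2 h3 rfl
    exact h3 (cross hα hγ hαγ h1 h2)
  have nβγ : ∀ {x y}, G.Adj β x → G.Adj γ y → x ≠ P → x ≠ y := by
    rintro x _ h1 h2 h3 rfl
    exact h3 (cross hβ hγ hβγ h1 h2)
  simp only [List.nodup_cons, List.mem_cons, List.not_mem_nil, or_false, not_or, List.nodup_nil,
    not_false_eq_true, and_true]
  exact ⟨⟨n12, (nαγ hp₁₂ hp₁ hp₁₂P).symm, n13, n1_13, hp₁₂₃, hp₁P⟩,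
    ⟨(nαβ hp₁₂ hp₂ hp₁₂P).symm, n23, hp₁₃₂.symm, nβγ hp₂ hp₂₃ hp₂P, hp₂P⟩,
    ⟨hp₁₂₃', nαβ hp₁₂ hp₁₃ hp₁₂P, nαγ hp₁₂ hp₂₃ hp₁₂P, hp₁₂P⟩,
    ⟨nαβ hp₃ hp₁₃ hp₃P, nαγ hp₃ hp₂₃ hp₃P, hp₃P⟩, ⟨nβγ hp₁₃ hp₂₃ hp₁₃P, hp₁₃P⟩, hp₂₃P⟩

/-! ### The Fano plane in coordinates and uniqueness of the Heawood graph. -/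

instance : DecidableRel heawoodGraph.Adj := fun x y =>
  match x, y with
  | Sum.inl p, Sum.inr l => inferInstanceAs (Decidable (p.1 ⬝ᵥ l.1 = 0))
  | Sum.inr l, Sum.inl p => inferInstanceAs (Decidable (p.1 ⬝ᵥ l.1 = 0))
  | Sum.inl _, Sum.inl _ => inferInstanceAs (Decidable False)
  | Sum.inr _, Sum.inr _ => inferInstanceAs (Decidable False)

theorem heawoodGraph_adj_inl_inr (p l : FanoCoord) :
    heawoodGraph.Adj (Sum.inl p) (Sum.inr l) ↔ p.1 ⬝ᵥ l.1 = 0 := Iff.rfl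

theorem heawoodGraph_adj_inr_inl (p l : FanoCoord) :
    heawoodGraph.Adj (Sum.inr l) (Sum.inl p) ↔ p.1 ⬝ᵥ l.1 = 0 := Iff.rfl

theorem not_heawoodGraph_adj_inl_inl (p q : FanoCoord) :
    ¬ heawoodGraph.Adj (Sum.inl p) (Sum.inl q) := id

theorem not_heawoodGraph_adj_inr_inr (k l : FanoCoord) :
    ¬ heawoodGraph.Adj (Sum.inr k) (Sum.inr l) := id

/-- The position of a coordinate vector in the list `100, 010, 110, 001, 101, 011, 111`. -/
def FanoCoord.index (v : FanoCoord) : Fin 7 :=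
  Fin.ofNat 7 ((v.1 0).val + 2 * (v.1 1).val + 4 * (v.1 2).val - 1)

theorem FanoCoord.index_injective : Function.Injective FanoCoord.index := by decide

/-- These are the entries of `N Nᵀ = 2I + J`, from which the spectrum is read off. -/
theorem FanoCoord.card_common_perp : ∀ p q : FanoCoord,
    #{l : FanoCoord | p.1 ⬝ᵥ l.1 = 0 ∧ q.1 ⬝ᵥ l.1 = 0} = if p = q then 3 else 1 := by decide

theorem FanoCoord.three_lt_card_perp_or : ∀ k l : FanoCoord, k ≠ l →
    3 < #{p : FanoCoord | p.1 ⬝ᵥ k.1 = 0 ∨ p.1 ⬝ᵥ l.1 = 0} := by decide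

theorem FanoCoord.card_eq : Fintype.card FanoCoord = 7 := by decide

/-- The 21 flags, in the order of the adjacencies in `exists_fano_labelling`. -/
theorem FanoCoord.index_mem : ∀ v l : FanoCoord, v.1 ⬝ᵥ l.1 = 0 →
    (FanoCoord.index v, FanoCoord.index l) ∈ ([(6, 2), (6, 4), (6, 5), (3, 2), (2, 2), (1, 4),
      (4, 4), (0, 5), (5, 5), (1, 0), (3, 0), (5, 0), (0, 1), (3, 1), (4, 1), (0, 3), (1, 3), (2, 3), (2, 6), (4, 6),
      (5, 6)] : List (Fin 7 × Fin 7)) := by decide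

theorem isRegularOfDegree_heawoodGraph : heawoodGraph.IsRegularOfDegree 3 := by
  unfold IsRegularOfDegree
  decide

theorem FanoCoord.exists_perp_perp : ∀ v w : FanoCoord,
    ∃ l : FanoCoord, v.1 ⬝ᵥ l.1 = 0 ∧ w.1 ⬝ᵥ l.1 = 0 := by decide

/-- A cubic graph on fourteen vertices without cycles of length four and five is the Heawood
graph. -/
theorem IsRegularOfDegree.nonempty_iso_heawoodGraph (hreg : G.IsRegularOfDegree 3)
    (h4 : ∀ {x y m m' : V}, x ≠ y → G.Adj m x → G.Adj m y → G.Adj m' x → G.Adj m' y → m = m')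
    (h5 : ∀ {a b c d e : V}, G.Adj a b → G.Adj b c → G.Adj c d → G.Adj d e → G.Adj e a → False)
    (hcard : Fintype.card V = 14) : Nonempty (G ≃g heawoodGraph) := by
  have : Nonempty V := Fintype.card_pos_iff.mp (by omega)
  have hxor : ∀ {u v : V}, G.Adj u v → ∀ x, x ∈ G.twoStep u ↔ x ∉ G.twoStep v :=
    fun huv x => hreg.mem_twoStep_iff_of_adj h4 h5 hcard huv x
  obtain ⟨P, p₁, p₂, p₃, p₁₂, p₁₃, p₂₃, α, β, γ, L₁, L₂, L₃, L₄, ⟨h1, h2, h3⟩, ⟨h6, h7⟩, ⟨h8, h9⟩,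
    ⟨h10, h11⟩, ⟨h12, h13, h14⟩, ⟨h15, h16, h17⟩, ⟨h18, h19, h20⟩, ⟨h21, h22, h23⟩, hnodup⟩ :=
    hreg.exists_fano_labelling h4 hxor
  -- Entries follow `FanoCoord.index`: `pᵢ` is the unit vector `eᵢ`, `pᵢⱼ` is `eᵢ + eⱼ`, and a line
  -- sits at its normal vector.
  let pt : FanoCoord → V := fun v => ![p₁, p₂, p₁₂, p₃, p₁₃, p₂₃, P] (FanoCoord.index v)
  let ln : FanoCoord → V := fun l => ![L₁, L₂, α, L₃, β, γ, L₄] (FanoCoord.index l)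
  have hadj : ∀ v l : FanoCoord, v.1 ⬝ᵥ l.1 = 0 → G.Adj (pt v) (ln l) := by
    intro v l hvl
    have hmem := FanoCoord.index_mem v l hvl
    simp only [pt, ln]
    generalize FanoCoord.index v = i at hmem ⊢
    generalize FanoCoord.index l = j at hmem ⊢
    simp only [List.mem_cons, Prod.mk.injEq, List.not_mem_nil, or_false] at hmem
    rcases hmem with h | h | h | h | h | h | h | h | h | h | h | h | h | h | h | h | h | h | h | h | h <;>
      (obtain ⟨rfl, rfl⟩ := h; assumption)
  have hpt : Function.Injective pt := by
    refine Function.Injective.comp ?_ FanoCoord.index_injective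
    rw [← List.nodup_ofFn]
    simpa [List.ofFn_succ] using hnodup
  -- If two lines coincided in `V`, their union of more than three points would lie in one
  -- neighbourhood.
  have hln : Function.Injective ln := by
    intro k l hkl
    by_contra hne
    have hle := Finset.card_le_card (s := image pt {p : FanoCoord | p.1 ⬝ᵥ k.1 = 0 ∨ p.1 ⬝ᵥ l.1 = 0})
      (t := G.neighborFinset (ln k)) (by
        intro x hx
        obtain ⟨p, hp, rfl⟩ := Finset.mem_image.mp hx
        rw [mem_neighborFinset]
        rcases (Finset.mem_filter.mp hp).2 with h | h
        · exact (hadj p k h).symm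
        · exact hkl ▸ (hadj p l h).symm)
    rw [Finset.card_image_of_injective _ hpt, card_neighborFinset_eq_degree, hreg.degree_eq] at hle
    exact absurd hle (not_le.mpr (FanoCoord.three_lt_card_perp_or k l hne))
  have hstep : ∀ v w, pt w ∈ G.twoStep (pt v) := by
    intro v w
    obtain ⟨l, hv, hw⟩ := FanoCoord.exists_perp_perp v w
    exact mem_twoStep.mpr ⟨ln l, hadj v l hv, (hadj w l hw).symm⟩
  -- All points lie in one class, whereas a line is in the class opposite to a point on it.
  have hne : ∀ v l, pt v ≠ ln l := by
    intro v l h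
    obtain ⟨w, hw, -⟩ := FanoCoord.exists_perp_perp l l
    rw [dotProduct_comm] at hw
    have h' := (hxor (hadj w l hw) (pt w)).mp (hstep w w)
    rw [← h] at h'
    exact h' (hstep v w)
  refine hreg.nonempty_iso_of_injective_hom isRegularOfDegree_heawoodGraph
    (by rw [Fintype.card_sum, FanoCoord.card_eq, hcard]) ⟨Sum.elim pt ln, ?_⟩ ?_
  · rintro (a | a) (b | b) h
    · exact h.elim
    · exact hadj a b h
    · exact (hadj b a h).symm
    · exact h.elim
  · exact hpt.sumElim hln hne

/-! ### The second eigenvalue of the Heawood graph. -/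

/-- In the Heawood graph every eigenvector for a positive eigenvalue other than `√2` is
constant. -/
theorem eigenvector_heawoodGraph_const {μ : ℝ} (hμ0 : 0 < μ) (hμ2 : μ ^ 2 ≠ 2)
    {x : FanoCoord ⊕ FanoCoord → ℝ}
    (hx : heawoodGraph.adjMatrix ℝ *ᵥ x = μ • x) : ∃ c : ℝ, ∀ w, x w = c := by
  set f : FanoCoord → ℝ := fun p => x (Sum.inl p)
  set g : FanoCoord → ℝ := fun l => x (Sum.inr l)
  have hf : ∀ p : FanoCoord, ∑ l : FanoCoord, (if p.1 ⬝ᵥ l.1 = 0 then g l else 0) = μ * f p := by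
    intro p
    have h := congrFun hx (Sum.inl p)
    rw [mulVec, dotProduct, Fintype.sum_sum_type] at h
    simpa only [adjMatrix_apply, heawoodGraph_adj_inl_inr, heawoodGraph_adj_inr_inl,
      not_heawoodGraph_adj_inl_inl, not_heawoodGraph_adj_inr_inr, if_false, zero_mul, ite_mul,
      one_mul, Finset.sum_const_zero, zero_add, add_zero, Pi.smul_apply, smul_eq_mul] using h
  have hg : ∀ l : FanoCoord, ∑ p : FanoCoord, (if l.1 ⬝ᵥ p.1 = 0 then f p else 0) = μ * g l := by
    intro l
    have h := congrFun hx (Sum.inr l)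
    simp_rw [dotProduct_comm l.1]
    rw [mulVec, dotProduct, Fintype.sum_sum_type] at h
    simpa only [adjMatrix_apply, heawoodGraph_adj_inl_inr, heawoodGraph_adj_inr_inl,
      not_heawoodGraph_adj_inl_inl, not_heawoodGraph_adj_inr_inr, if_false, zero_mul, ite_mul,
      one_mul, Finset.sum_const_zero, zero_add, add_zero, Pi.smul_apply, smul_eq_mul] using h
  -- Stated for any pair, so that it applies to points and lines alike: it is `N Nᵀ f = μ² f` with
  -- `N Nᵀ = 2I + J`.
  have key : ∀ f g : FanoCoord → ℝ,
      (∀ p : FanoCoord, ∑ l : FanoCoord, (if p.1 ⬝ᵥ l.1 = 0 then g l else 0) = μ * f p) →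
      (∀ l : FanoCoord, ∑ p : FanoCoord, (if l.1 ⬝ᵥ p.1 = 0 then f p else 0) = μ * g l) →
      ∀ p, (μ ^ 2 - 2) * f p = ∑ q, f q := by
    intro f g hf hg p
    have h : ∑ l : FanoCoord, (if p.1 ⬝ᵥ l.1 = 0 then μ * g l else 0) = μ ^ 2 * f p := by
      rw [pow_two, mul_assoc, ← hf, Finset.mul_sum]
      exact Finset.sum_congr rfl fun l _ => by rw [mul_ite, mul_zero]
    have h' : ∑ l : FanoCoord, (if p.1 ⬝ᵥ l.1 = 0 then μ * g l else 0) =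
        ∑ q : FanoCoord, (if p = q then 3 else 1) * f q := by
      calc _ = ∑ l : FanoCoord, ∑ q : FanoCoord,
            (if p.1 ⬝ᵥ l.1 = 0 ∧ q.1 ⬝ᵥ l.1 = 0 then f q else 0) := by
            refine Finset.sum_congr rfl fun l _ => ?_
            rw [← hg]
            by_cases hp : p.1 ⬝ᵥ l.1 = 0
            · simp_rw [if_pos hp, hp, true_and, dotProduct_comm l.1]
            · simp_rw [if_neg hp, hp, false_and, if_false, Finset.sum_const_zero]
        _ = _ := by
            rw [Finset.sum_comm]
            refine Finset.sum_congr rfl fun q _ => ?_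
            rw [← Finset.sum_filter, Finset.sum_const, FanoCoord.card_common_perp, nsmul_eq_mul]
            split_ifs <;> simp
    have h'' : ∑ q : FanoCoord, (if p = q then (3 : ℝ) else 1) * f q = 2 * f p + ∑ q, f q := by
      have : ∀ q, (if p = q then (3 : ℝ) else 1) * f q = (if p = q then 2 * f q else 0) + f q := by
        intro q
        split_ifs <;> ring
      simp_rw [this, Finset.sum_add_distrib, Finset.sum_ite_eq, Finset.mem_univ, if_true]
    linarith
  have hF := key f g hf hg
  have hG := key g f hg hf
  have hpos : μ ^ 2 - 2 ≠ 0 := sub_ne_zero.mpr hμ2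
  have hfc : ∀ p, f p = (∑ q, f q) / (μ ^ 2 - 2) := fun p => by
    rw [eq_div_iff hpos, mul_comm, hF]
  have hgc : ∀ p, g p = (∑ q, g q) / (μ ^ 2 - 2) := fun p => by
    rw [eq_div_iff hpos, mul_comm, hG]
  set a := (∑ q, f q) / (μ ^ 2 - 2)
  set b := (∑ q, g q) / (μ ^ 2 - 2)
  have hcount : ∀ p : FanoCoord, ∀ c : ℝ,
      ∑ l : FanoCoord, (if p.1 ⬝ᵥ l.1 = 0 then c else 0) = 3 * c := by
    intro p c
    have := FanoCoord.card_common_perp p p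
    simp only [and_self, if_true] at this
    rw [← Finset.sum_filter, Finset.sum_const, this, nsmul_eq_mul]
    norm_num
  let p₀ : FanoCoord := ⟨1, by decide⟩
  have h1 : 3 * b = μ * a := by
    rw [← hfc p₀, ← hf p₀, ← hcount p₀]
    exact Finset.sum_congr rfl fun l _ => by rw [hgc]
  have h2 : 3 * a = μ * b := by
    rw [← hgc p₀, ← hg p₀, ← hcount p₀]
    exact Finset.sum_congr rfl fun l _ => by rw [hfc]
  have hab : a = b := by
    have : (μ + 3) * (a - b) = 0 := by linarith
    exact sub_eq_zero.mp ((mul_eq_zero.mp this).resolve_left (by positivity))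
  refine ⟨a, ?_⟩
  rintro (p | l)
  · exact hfc p
  · exact (hgc l).trans hab.symm

theorem eigenvector_const_of_iso_heawoodGraph (e : G ≃g heawoodGraph) {μ : ℝ} (hμ0 : 0 < μ)
    (hμ2 : μ ^ 2 ≠ 2) {x : V → ℝ} (hx : G.adjMatrix ℝ *ᵥ x = μ • x) : ∃ c : ℝ, x = c • 1 := by
  obtain ⟨c, hc⟩ := eigenvector_heawoodGraph_const hμ0 hμ2 (x := fun w => x (e.symm w)) (by
    ext w
    have h := congrFun hx (e.symm w)
    rw [Pi.smul_apply] at h ⊢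
    rw [← h]
    simp only [mulVec, dotProduct, adjMatrix_apply]
    rw [← e.symm.toEquiv.sum_comp]
    refine Finset.sum_congr rfl fun w' _ => ?_
    congr 2
    exact propext e.symm.map_rel_iff.symm)
  refine ⟨c, funext fun v => ?_⟩
  have := hc (e v)
  simpa using this

/-- The second eigenvalue of the Heawood graph, once known to exceed `1`, is `√2`. -/
theorem IsRegularOfDegree.secondEigenvalue_eq_of_iso_heawoodGraph (hreg : G.IsRegularOfDegree 3)
    (e : G ≃g heawoodGraph) (h1 : 1 < G.secondEigenvalue) : G.secondEigenvalue = √2 := by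
  have hcard : Fintype.card V = 14 := by
    rw [Fintype.card_congr e.toEquiv, Fintype.card_sum, FanoCoord.card_eq]
  have hle : G.secondEigenvalue ≤ √2 := by
    refine secondEigenvalue_le_of_eigenvectors_const (by omega) fun μ x hμ hx => ?_
    have hμ0 := (Real.sqrt_nonneg 2).trans_lt hμ
    exact eigenvector_const_of_iso_heawoodGraph e hμ0 ((Real.sqrt_lt' hμ0).mp hμ).ne' hx
  have hlt : G.secondEigenvalue < (3 : ℕ) := by
    have := sqrt_two_bounds.2
    push_cast
    linarith
  obtain ⟨x, hx, hx1, hAx⟩ := hreg.exists_eigenvector_secondEigenvalue (by omega) hlt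
  -- Otherwise the eigenvector of entry sum zero would be constant, hence zero. Only the positivity
  -- of `λ₂` is needed from `h1` here.
  by_contra hne
  obtain ⟨c, rfl⟩ := eigenvector_const_of_iso_heawoodGraph e (by linarith)
    (fun h => hne ((Real.sqrt_eq_iff_eq_sq (by norm_num) (by linarith)).mpr h.symm).symm) hAx
  rw [dotProduct_smul, one_dotProduct_one, hcard] at hx1
  refine hx ?_
  rw [(mul_eq_zero.mp hx1).resolve_right (by norm_num), zero_smul]

/-! ### Assembly. -/

/-- A cubic graph with `1 < λ₂ ≤ √2` is the Heawood graph. -/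
theorem IsRegularOfDegree.nonempty_iso_heawoodGraph_of_le (hreg : G.IsRegularOfDegree 3)
    (h1 : 1 < G.secondEigenvalue) (hθ : G.secondEigenvalue ≤ √2) :
    Nonempty (G ≃g heawoodGraph) := by
  have h12 := hreg.twelve_le_card h1 hθ
  have h16 := hreg.card_lt_sixteen hθ
  have : Nonempty V := Fintype.card_pos_iff.mp (by omega)
  have h4 : ∀ {x y m m' : V}, x ≠ y → G.Adj m x → G.Adj m y → G.Adj m' x → G.Adj m' y → m = m' :=
    fun hxy a b c d => hreg.no_four_cycle hθ (by omega) hxy a b c d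
  have h5 : ∀ {a b c d e : V},
      G.Adj a b → G.Adj b c → G.Adj c d → G.Adj d e → G.Adj e a → False :=
    fun a b c d e => hreg.no_five_cycle hθ h12 a b c d e
  have h14 := hreg.fourteen_le_card h4 h5
  have heven := hreg.even_card
  exact hreg.nonempty_iso_heawoodGraph h4 h5 (by omega)

end SimpleGraph

theorem mainTheorem4 {V : Type*} [Fintype V] [DecidableEq V] (G : SimpleGraph V)
    [DecidableRel G.Adj] (hconn : G.Connected) (hreg : G.IsRegularOfDegree 3)
    (hlam : 1 < G.secondEigenvalue) :
    Real.sqrt 2 ≤ G.secondEigenvalue ∧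
      (G.secondEigenvalue = Real.sqrt 2 ↔ Nonempty (G ≃g heawoodGraph)) := by
  refine ⟨?_, fun h => hreg.nonempty_iso_heawoodGraph_of_le hlam h.le,
    fun ⟨e⟩ => hreg.secondEigenvalue_eq_of_iso_heawoodGraph e hlam⟩
  by_contra! hlt
  obtain ⟨e⟩ := hreg.nonempty_iso_heawoodGraph_of_le hlam hlt.le
  exact hlt.ne (hreg.secondEigenvalue_eq_of_iso_heawoodGraph e hlam)
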